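/- Let $K$ be a unital commutative $\mathbb{Q}$-algebra, let $z=(z_1,\dots,z_n)$ be free variables, either commutative or noncommutative, and let $t$ be a central parameter. Write $K\langle\langle z\rangle\rangle$ and $K[[t]]\langle\langle z\rangle\rangle$ for the algebras of formal power series in $z$ over $K$ and over $K[[t]]$ (in the commutative case these are $K[[z]]$ and $K[[t]][[z]]$). Let $F_t$ be an automorphism of the $K[[t]]$-algebra $K[[t]]\langle\langle z\rangle\rangle$ of the form $F_t(z)=z-tH(z)$ with $H=(H_1,\dots,H_n)\in K\langle\langle z\rangle\rangle^{\times n}$ such that every $H_i$ has zero constant term, and let $G_t=F_t^{-1}$ be its inverse. Let $\lambda_m$ $(m\ge 0)$ be the $K$-linear operators on $K\langle\langle z\rangle\rangle$ determined by the Taylor expansion $$u(F_t(z))=\sum_{m\ge 0}(-1)^m t^m\,\lambda_m u(z)\qquad (u\in K\langle\langle z\rangle\rangle).$$ Then $G_t(z)=z+tN_t(z)$ with $N_t(z)=\sum_{m\ge 1}t^{m-1}N_{[m]}(z)$, $N_{[m]}(z)\in K\langle\langle z\rangle\rangle^{\times n}$, and for every $m\ge 1$ $$N_{[m]}(z)=(-1)^m\sum_{I\in\mathcal{C}_m}(-1)^{\ell(I)}\,\lambda^I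 z ,$$ where $\mathcal{C}_m$ is the set of compositions $I=(i_1,\dots,i_k)$ of $m$ (ordered sequences of positive integers with sum $m$), $\ell(I)=k$, and $\lambda^I=\lambda_{i_1}\lambda_{i_2}\cdots\lambda_{i_k}$. Here, for every $m\ge 1$ and $u\in K\langle\langle z\rangle\rangle$, $$\lambda_m u(z)=\frac{1}{m!}\left.\left[H(w)\frac{\partial}{\partial z}\right]^m u(z)\right|_{w=z},$$ where $w=(w_1,\dots,w_n)$ are further free variables, $[H(w)\frac{\partial}{\partial z}]$ is the derivation of the formal power series in $z,w$ with $z_i\mapsto H_i(w)$ and $w_i\mapsto 0$ (the letter-by-letter replacement given by the Leibniz rule, extended termwise to series), and $|_{w=z}$ means that $w_i$ is replaced by $z_i$ after the derivation has been applied $m$ times. If the variables $z$ are commutative, then moreover $$\lambda_m=\sum_{I\in\mathbb{N}^n,\ |I|=m}\frac{1}{I!}\,H^I(z)\,\frac{\partial^m}{\partial z^I}.$$ -/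

import Mathlib

open scoped PowerSeries Nat

noncomputable section

/-! ## Noncommutative formal power series -/

/-- `R⟨⟨σ⟩⟩`: formal power series over `R` in noncommutative free variables indexed by `σ`.
A series is its family of coefficients, indexed by the words in the alphabet `σ`. -/
def NCSeries (σ : Type*) (R : Type*) : Type _ := List σ → R

namespace NCSeries

variable {σ τ R : Type*}

@[ext] theorem ext {f g : NCSeries σ R} (h : ∀ w, f w = g w) : f = g := funext h

instance [AddCommGroup R] : AddCommGroup (NCSeries σ R) :=
  inferInstanceAs (AddCommGroup (List σ → R))

instance [CommRing R] : Module R (NCSeries σ R) :=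
  inferInstanceAs (Module R (List σ → R))

/-- The Cauchy product: the coefficient of `f * g` at a word `w` is the sum of
`f a * g b` over all factorizations `w = a b`. -/
instance [CommRing R] : Mul (NCSeries σ R) :=
  ⟨fun f g w => ∑ k ∈ Finset.range (w.length + 1), f (w.take k) * g (w.drop k)⟩

instance [CommRing R] : One (NCSeries σ R) :=
  ⟨fun w => match w with
    | [] => 1
    | _ :: _ => 0⟩

/-- The variable `z_i`, i.e. the one-letter word `i`. -/
def X [CommRing R] [DecidableEq σ] (i : σ) : NCSeries σ R :=
  fun w => if w = [i] then 1 else 0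

/-- The left quotient by a letter: `(leftQuot x f) w = f (x w)`. -/
def leftQuot (x : σ) (f : NCSeries σ R) : NCSeries σ R := fun w => f (x :: w)

@[simp] theorem leftQuot_apply (x : σ) (f : NCSeries σ R) (w : List σ) :
    leftQuot x f w = f (x :: w) := rfl

section Ring

variable [CommRing R]

@[simp] theorem add_apply (f g : NCSeries σ R) (w : List σ) : (f + g) w = f w + g w := rfl
@[simp] theorem zero_apply (w : List σ) : (0 : NCSeries σ R) w = 0 := rfl
@[simp] theorem smul_apply (r : R) (f : NCSeries σ R) (w : List σ) : (r • f) w = r * f w := rfl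
@[simp] theorem one_nil : (1 : NCSeries σ R) [] = 1 := rfl
@[simp] theorem one_cons (x : σ) (w : List σ) : (1 : NCSeries σ R) (x :: w) = 0 := rfl

theorem mul_apply (f g : NCSeries σ R) (w : List σ) :
    (f * g) w = ∑ k ∈ Finset.range (w.length + 1), f (w.take k) * g (w.drop k) := rfl

@[simp] theorem mul_nil (f g : NCSeries σ R) : (f * g) [] = f [] * g [] := by
  simp [mul_apply]

@[simp] theorem mul_cons (f g : NCSeries σ R) (x : σ) (w : List σ) :
    (f * g) (x :: w) = f [] * g (x :: w) + (leftQuot x f * g) w := by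
  rw [mul_apply, List.length_cons, Finset.sum_range_succ', add_comm]
  simp [mul_apply]

theorem sum_apply {ι : Type*} (s : Finset ι) (f : ι → NCSeries σ R) (w : List σ) :
    (∑ i ∈ s, f i) w = ∑ i ∈ s, f i w :=
  Finset.sum_apply w s f

protected theorem add_mul' (f g h : NCSeries σ R) : (f + g) * h = f * h + g * h := by
  ext w; simp [mul_apply, add_mul, Finset.sum_add_distrib]

protected theorem mul_add' (f g h : NCSeries σ R) : f * (g + h) = f * g + f * h := by
  ext w; simp [mul_apply, mul_add, Finset.sum_add_distrib]

protected theorem smul_mul' (r : R) (f g : NCSeries σ R) : (r • f) * g = r • (f * g) := by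
  ext w; simp [mul_apply, mul_assoc, Finset.mul_sum]

protected theorem mul_smul' (r : R) (f g : NCSeries σ R) : f * (r • g) = r • (f * g) := by
  ext w; simp [mul_apply, mul_left_comm, Finset.mul_sum]

theorem leftQuot_mul (x : σ) (f g : NCSeries σ R) :
    leftQuot x (f * g) = f [] • leftQuot x g + leftQuot x f * g := by
  ext w; simp

protected theorem mul_assoc' (f g h : NCSeries σ R) : f * g * h = f * (g * h) := by
  ext w
  induction w generalizing f with
  | nil => simp [mul_assoc]
  | cons x w ih =>
    rw [mul_cons, mul_cons f, leftQuot_mul, NCSeries.add_mul', NCSeries.smul_mul', mul_nil,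
      add_apply, smul_apply, ih, mul_cons g]
    ring

protected theorem one_mul' (f : NCSeries σ R) : 1 * f = f := by
  ext w
  cases w with
  | nil => simp
  | cons x w =>
    have h : leftQuot x (1 : NCSeries σ R) = 0 := rfl
    rw [mul_cons, h]
    simp [mul_apply]

protected theorem mul_one' (f : NCSeries σ R) : f * 1 = f := by
  ext w
  induction w generalizing f with
  | nil => simp
  | cons x w ih => rw [mul_cons, ih]; simp

instance : Ring (NCSeries σ R) :=
  { (inferInstance : AddCommGroup (NCSeries σ R)) with
    mul := (· * ·)
    one := 1
    left_distrib := NCSeries.mul_add'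
    right_distrib := NCSeries.add_mul'
    zero_mul := fun f => by ext w; simp [mul_apply]
    mul_zero := fun f => by ext w; simp [mul_apply]
    mul_assoc := NCSeries.mul_assoc'
    one_mul := NCSeries.one_mul'
    mul_one := NCSeries.mul_one' }

instance : Algebra R (NCSeries σ R) :=
  Algebra.ofModule NCSeries.smul_mul' NCSeries.mul_smul'

/-- The derivation `[u ∂/∂z] = ∑ i, [u i ∂/∂z_i]`, sending `z_i` to `u i`. It replaces, in each
word, one letter `i` at a time by the series `u i`: the coefficient at `v` is the sum, over all
factorizations `v = a b c` and all letters `i`, of (coefficient of `f` at `a i c`) times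
(coefficient of `u i` at `b`). -/
def deriv [Fintype σ] (u : σ → NCSeries σ R) : NCSeries σ R →ₗ[R] NCSeries σ R where
  toFun f := fun v =>
    ∑ p ∈ Finset.range (v.length + 1), ∑ q ∈ Finset.range ((v.drop p).length + 1),
      ∑ i, f (v.take p ++ i :: (v.drop p).drop q) * u i ((v.drop p).take q)
  map_add' f g := by
    ext v; simp [add_mul, Finset.sum_add_distrib]; rfl
  map_smul' r f := by
    ext v; simp only [smul_apply, mul_assoc, ← Finset.mul_sum]; rfl

theorem deriv_apply [Fintype σ] (u : σ → NCSeries σ R) (f : NCSeries σ R) (v : List σ) :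
    deriv u f v =
      ∑ p ∈ Finset.range (v.length + 1), ∑ q ∈ Finset.range ((v.drop p).length + 1),
        ∑ i, f (v.take p ++ i :: (v.drop p).drop q) * u i ((v.drop p).take q) := rfl

theorem deriv_nil [Fintype σ] (u : σ → NCSeries σ R) (f : NCSeries σ R) :
    deriv u f [] = ∑ i, u i [] * f [i] := by
  simp [deriv_apply, mul_comm]

theorem deriv_cons [Fintype σ] (u : σ → NCSeries σ R) (f : NCSeries σ R) (x : σ) (v : List σ) :
    deriv u f (x :: v) = (∑ i, u i * leftQuot i f) (x :: v) + deriv u (leftQuot x f) v := by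
  rw [deriv_apply, List.length_cons, Finset.sum_range_succ', add_comm, sum_apply]
  congr 1
  simp only [List.drop_zero, List.take_zero, List.nil_append, mul_apply, leftQuot_apply]
  rw [Finset.sum_comm]
  simp [mul_comm]

theorem leftQuot_deriv [Fintype σ] (u : σ → NCSeries σ R) (f : NCSeries σ R) (x : σ) :
    leftQuot x (deriv u f) =
      leftQuot x (∑ i, u i * leftQuot i f) + deriv u (leftQuot x f) := by
  ext v; exact deriv_cons u f x v

/-- `[u ∂/∂z]` satisfies the Leibniz rule. -/
theorem deriv_mul [Fintype σ] (u : σ → NCSeries σ R) (f g : NCSeries σ R) :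
    deriv u (f * g) = deriv u f * g + f * deriv u g := by
  have key : ∀ f : NCSeries σ R, (∑ i, u i * leftQuot i (f * g)) =
      f [] • (∑ i, u i * leftQuot i g) + (∑ i, u i * leftQuot i f) * g := by
    intro f
    simp only [leftQuot_mul, mul_add, Finset.sum_add_distrib, Finset.smul_sum, Finset.sum_mul,
      mul_smul_comm, mul_assoc]
  ext v
  induction v generalizing f with
  | nil =>
    simp only [deriv_nil, add_apply, mul_nil, mul_cons, leftQuot_apply, Finset.sum_mul,
      Finset.mul_sum, ← Finset.sum_add_distrib]
    refine Finset.sum_congr rfl fun i _ => ?_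
    ring
  | cons x v ih =>
    rw [deriv_cons, key, leftQuot_mul, map_add, map_smul, add_apply, add_apply, smul_apply,
      smul_apply, ih, add_apply, add_apply, mul_cons, mul_cons, mul_cons, leftQuot_deriv,
      NCSeries.add_mul', add_apply, deriv_cons u g]
    have h0 : deriv u f [] = (∑ i, u i * leftQuot i f) [] := by
      rw [deriv_nil, sum_apply]; simp
    rw [h0]
    ring

/-- `[u ∂/∂z]` sends `z_j` to `u j`. -/
theorem deriv_X [Fintype σ] [DecidableEq σ] (u : σ → NCSeries σ R) (j : σ) :
    deriv u (X j) = u j := by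
  have h1 : ∀ i, leftQuot i (X j : NCSeries σ R) = if i = j then 1 else 0 := by
    intro i
    ext w
    by_cases hij : i = j <;> cases w <;> simp [X, hij]
  have h2 : deriv u (1 : NCSeries σ R) = 0 := by
    have := deriv_mul u (1 : NCSeries σ R) 1
    simpa using this
  ext v
  cases v with
  | nil => simp [deriv_nil, X]
  | cons x v =>
    rw [deriv_cons, h1]
    have h3 : deriv u (if x = j then (1 : NCSeries σ R) else 0) = 0 := by
      split_ifs
      · exact h2
      · exact map_zero _
    rw [h3]
    simp [h1]

/-- Renaming of finitely many variables along `ρ : σ → τ`, i.e. the substitution `z_i ↦ z_{ρ i}`: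
the coefficient at a word `v` is the sum of the coefficients at the (finitely many) words
that become `v`. -/
def rename [Finite σ] (ρ : σ → τ) (f : NCSeries σ R) : NCSeries τ R :=
  fun v => ∑ᶠ (w : List σ) (_ : w.map ρ = v), f w

/-- The derivation `[H(w) ∂/∂z]` of the series in the `2n` free variables `z, w`
(`z_i` is the variable `Sum.inl i` and `w_i` is the variable `Sum.inr i`):
it sends `z_i` to `H_i(w)` and `w_i` to `0`. -/
def doubledDeriv {n : ℕ} (H : Fin n → NCSeries (Fin n) R) :
    NCSeries (Fin n ⊕ Fin n) R →ₗ[R] NCSeries (Fin n ⊕ Fin n) R :=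
  deriv (Sum.elim (fun i => rename Sum.inr (H i)) 0)

/-- `[H(w) ∂/∂z]^m u(z) |_{w = z}`. -/
def frozenDerivPow {n : ℕ} (H : Fin n → NCSeries (Fin n) R) (m : ℕ)
    (u : NCSeries (Fin n) R) : NCSeries (Fin n) R :=
  rename (Sum.elim id id) ((doubledDeriv H ^ m) (rename Sum.inl u))

end Ring

section Deformation

variable {K : Type*} [CommRing K]

/-- The inclusion of `K⟨⟨z⟩⟩` in `K[[t]]⟨⟨z⟩⟩`. -/
def base (u : NCSeries σ K) : NCSeries σ K⟦X⟧ := fun w => PowerSeries.C (u w)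

/-- The coefficient in `K⟨⟨z⟩⟩` of `t ^ m` in an element of `K[[t]]⟨⟨z⟩⟩`. -/
def tCoeff (m : ℕ) (f : NCSeries σ K⟦X⟧) : NCSeries σ K := fun w => PowerSeries.coeff m (f w)

/-- The element `∑ m, t ^ m c_m` of `K[[t]]⟨⟨z⟩⟩`. -/
def ofTCoeffs (c : ℕ → NCSeries σ K) : NCSeries σ K⟦X⟧ :=
  fun w => PowerSeries.mk fun m => c m w

/-- The operators `λ_m` on `K⟨⟨z⟩⟩` attached to an automorphism `F_t` of `K[[t]]⟨⟨z⟩⟩`, determined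
by the Taylor expansion `u(F_t) = ∑ m, (-t) ^ m λ_m u`. -/
def lam {n : ℕ} (F : NCSeries (Fin n) K⟦X⟧ ≃ₐ[K⟦X⟧] NCSeries (Fin n) K⟦X⟧) (m : ℕ) :
    NCSeries (Fin n) K →ₗ[K] NCSeries (Fin n) K where
  toFun u := (-1 : K) ^ m • tCoeff m (F (base u))
  map_add' u v := by
    have h : base (u + v) = base u + base v := by
      ext w : 1; exact map_add PowerSeries.C _ _
    rw [h, map_add, ← smul_add]
    rfl
  map_smul' r u := by
    have h : base (r • u) = PowerSeries.C r • base u := by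
      ext w : 1; exact map_mul PowerSeries.C _ _
    rw [h, map_smul, RingHom.id_apply, smul_comm]
    congr 1
    ext w; exact PowerSeries.coeff_C_mul m _ r

/-- `N_[m]` (for `m ≥ 1`), the coefficient of `t ^ m` in the inverse map `G_t = F_t⁻¹`. -/
def invCoeff {n : ℕ} (F : NCSeries (Fin n) K⟦X⟧ ≃ₐ[K⟦X⟧] NCSeries (Fin n) K⟦X⟧) (m : ℕ)
    (i : Fin n) : NCSeries (Fin n) K :=
  tCoeff m (F.symm (X i))

end Deformation

end NCSeries

/-! ## Commutative formal power series -/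

namespace CommSeries

variable {σ R : Type*} [CommRing R]

/-- The derivation `[u ∂/∂z] = ∑ i, u i ∂/∂z_i`. -/
def deriv [Fintype σ] (u : σ → MvPowerSeries σ R) : MvPowerSeries σ R →ₗ[R] MvPowerSeries σ R :=
  ∑ i, LinearMap.mulLeft R (u i) ∘ₗ (MvPowerSeries.pderiv R i).toLinearMap

/-- Renaming of finitely many variables along `ρ`, i.e. the substitution `z_i ↦ z_{ρ i}`. -/
def rename {τ : Type*} [Finite σ] (ρ : σ → τ) (f : MvPowerSeries σ R) : MvPowerSeries τ R :=
  haveI : Filter.TendstoCofinite ρ := Filter.tendstoCofinite_of_finite ρ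
  MvPowerSeries.rename ρ f

/-- The derivation `[H(w) ∂/∂z]` of the series in the `2n` variables `z, w`
(`z_i` is the variable `Sum.inl i` and `w_i` is the variable `Sum.inr i`):
it sends `z_i` to `H_i(w)` and `w_i` to `0`. -/
def doubledDeriv {n : ℕ} (H : Fin n → MvPowerSeries (Fin n) R) :
    MvPowerSeries (Fin n ⊕ Fin n) R →ₗ[R] MvPowerSeries (Fin n ⊕ Fin n) R :=
  deriv (Sum.elim (fun i => rename Sum.inr (H i)) 0)

/-- `[H(w) ∂/∂z]^m u(z) |_{w = z}`. -/
def frozenDerivPow {n : ℕ} (H : Fin n → MvPowerSeries (Fin n) R) (m : ℕ)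
    (u : MvPowerSeries (Fin n) R) : MvPowerSeries (Fin n) R :=
  rename (Sum.elim id id) ((doubledDeriv H ^ m) (rename Sum.inl u))

/-- The operator `∂^{|I|} / ∂z^I = (∂/∂z_1)^{I_1} ⋯ (∂/∂z_n)^{I_n}`. -/
def partialPow {n : ℕ} (I : Fin n → ℕ) : Module.End R (MvPowerSeries (Fin n) R) :=
  (List.ofFn fun i =>
    ((MvPowerSeries.pderiv R i).toLinearMap : Module.End R (MvPowerSeries (Fin n) R)) ^ I i).prod

variable {K : Type*} [CommRing K]

/-- The coefficient in `K[[z]]` of `t ^ m` in an element of `K[[t]][[z]]`. -/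
def tCoeff (m : ℕ) (f : MvPowerSeries σ K⟦X⟧) : MvPowerSeries σ K :=
  fun e => PowerSeries.coeff m (MvPowerSeries.coeff e f)

/-- The element `∑ m, t ^ m c_m` of `K[[t]][[z]]`. -/
def ofTCoeffs (c : ℕ → MvPowerSeries σ K) : MvPowerSeries σ K⟦X⟧ :=
  fun e => PowerSeries.mk fun m => MvPowerSeries.coeff e (c m)

/-- The inclusion of `K[[z]]` in `K[[t]][[z]]`. -/
def base (u : MvPowerSeries σ K) : MvPowerSeries σ K⟦X⟧ :=
  MvPowerSeries.map (PowerSeries.C : K →+* K⟦X⟧) u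

/-- The operators `λ_m` on `K[[z]]` attached to an automorphism `F_t` of `K[[t]][[z]]`, determined
by the Taylor expansion `u(F_t) = ∑ m, (-t) ^ m λ_m u`. -/
def lam {n : ℕ} (F : MvPowerSeries (Fin n) K⟦X⟧ ≃ₐ[K⟦X⟧] MvPowerSeries (Fin n) K⟦X⟧) (m : ℕ) :
    MvPowerSeries (Fin n) K →ₗ[K] MvPowerSeries (Fin n) K where
  toFun u := (-1 : K) ^ m • tCoeff m (F (base u))
  map_add' u v := by
    have h : base (u + v) = base u + base v := map_add _ _ _
    rw [h, map_add, ← smul_add]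
    rfl
  map_smul' r u := by
    have h : base (r • u) = PowerSeries.C r • base u := by
      ext e : 1; simp [base]
    rw [h, map_smul, RingHom.id_apply, smul_comm]
    congr 1
    ext e; exact PowerSeries.coeff_C_mul m _ r

/-- `N_[m]` (for `m ≥ 1`), the coefficient of `t ^ m` in the inverse map `G_t = F_t⁻¹`. -/
def invCoeff {n : ℕ} (F : MvPowerSeries (Fin n) K⟦X⟧ ≃ₐ[K⟦X⟧] MvPowerSeries (Fin n) K⟦X⟧)
    (m : ℕ) (i : Fin n) : MvPowerSeries (Fin n) K :=
  tCoeff m (F.symm (MvPowerSeries.X i))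

end CommSeries

/-- `w^I = w_{i_1} w_{i_2} ⋯ w_{i_k}` for a composition `I = (i_1, …, i_k)`. -/
def compositionProd {A : Type*} [Monoid A] (w : ℕ → A) {m : ℕ} (I : Composition m) : A :=
  (I.blocks.map w).prod

end

/-! Two independent facts, each proved abstractly and then used for both kinds of variables.
Inversion: `F` commutes with multiplication by `t`, so on all series over `K⟦X⟧` it acts as the
operator series `∑ (-t)^m λ_m` with `λ_0 = 1`. Comparing coefficients of `t` in `F x = z_i` gives a
recursion whose unrolling is the geometric series, indexed by compositions
(`coeff_eq_sum_composition`). Identification of `λ_m`: since `F` is multiplicative, the `λ_m`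
satisfy the Leibniz rule of a Hasse–Schmidt family, and so do the divided powers of the frozen
derivation. Both families send `z_i` to `z_i, H_i, 0, 0, …`. Continuity of `F` is not assumed, so
agreement on the variables is propagated by showing that the difference has order at least `k` for
every `k` (`hasseSchmidt_ext`); here `H` having no constant term is essential. The case `m = 0` also
supplies `λ_0 = 1` for the inversion. For commuting variables, the operators `H_i(w) ∂/∂z_i` commute
and the multinomial theorem gives the explicit formula. -/

/-- Splitting off the first block of a composition. -/
theorem sum_composition_succ {V : Type*} [AddCommMonoid V] (f : List ℕ → V) (m : ℕ) :
    ∑ I : Composition (m + 1), f I.blocks =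
      ∑ a : Fin (m + 1), ∑ J : Composition (m - a), f ((a + 1) :: J.blocks) := by
  rw [← Fintype.sum_sigma' (fun (a : Fin (m + 1)) (J : Composition (m - a)) =>
    f (((a : ℕ) + 1) :: J.blocks))]
  symm
  -- The index `a` is the first block minus one, so the remaining blocks sum to `(m + 1) - (a + 1) =
  -- m - a`.
  refine Fintype.sum_bijective
    (fun x : (Σ a : Fin (m + 1), Composition (m - a)) =>
      (⟨((x.1 : ℕ) + 1) :: x.2.blocks, by
        intro i hi
        rcases List.mem_cons.1 hi with rfl | hi
        · omega
        · exact x.2.blocks_pos hi, by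
        have := x.1.2
        rw [List.sum_cons, x.2.blocks_sum]; omega⟩ : Composition (m + 1))) ⟨?_, ?_⟩ _ _
    (fun _ => rfl)
  · rintro ⟨a, I⟩ ⟨b, J⟩ h
    have h' := congrArg Composition.blocks h
    simp only [List.cons.injEq, add_left_inj] at h'
    obtain ⟨h1, h2⟩ := h'
    obtain rfl := Fin.ext h1
    obtain rfl := Composition.ext h2
    rfl
  · rintro ⟨l, hl, hs⟩
    cases l with
    | nil => simp at hs
    | cons a l =>
      have ha : 0 < a := hl (by simp)
      rw [List.sum_cons] at hs
      refine ⟨⟨⟨a - 1, by omega⟩, ⟨l, fun hi => hl (List.mem_cons_of_mem _ hi), ?_⟩⟩, ?_⟩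
      · simp only; omega
      · ext1
        simp only [List.cons.injEq, and_true]
        omega

/-! ### Inverting an operator series in a parameter -/

section Inversion

variable {K V M : Type*} [CommRing K] [AddCommGroup V] [Module K V] [AddCommGroup M]

/-- The coefficients of `F x` for a map `F` commuting with multiplication by the parameter. -/
theorem coeff_apply_eq_sum_antidiagonal (T F : M →+ M) (c : ℕ → M →+ V) (b : V → M)
    (L : ℕ → Module.End K V) (hFT : ∀ x, F (T x) = T (F x))
    (hT0 : ∀ x, c 0 (T x) = 0) (hT : ∀ m x, c (m + 1) (T x) = c m x)
    (hdec : ∀ x, ∃ y, x = b (c 0 x) + T y)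
    (hb : ∀ v m, c (m + 1) (b v) = 0)
    (hL : ∀ m v, c m (F (b v)) = (-1 : K) ^ m • L m v) (m : ℕ) (x : M) :
    c m (F x) = ∑ p ∈ Finset.HasAntidiagonal.antidiagonal m, (-1 : K) ^ p.1 • L p.1 (c p.2 x) := by
  -- Peel off the constant term, `x = b (c 0 x) + T y`: as `F` commutes with `T`, coefficient `m +
  -- 1` of `F (T y)` is coefficient `m` of `F y`. Only finitely many peelings occur, so no
  -- convergence in the parameter is needed.
  induction m generalizing x with
  | zero =>
    obtain ⟨y, hy⟩ := hdec x
    conv_lhs => rw [hy, map_add, map_add, hFT, hT0, hL]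
    simp
  | succ m ih =>
    obtain ⟨y, hy⟩ := hdec x
    have hy' : ∀ k, c (k + 1) x = c k y := fun k => by
      conv_lhs => rw [hy, map_add, hb, hT, zero_add]
    conv_lhs => rw [hy, map_add, map_add, hFT, hT, hL, ih]
    rw [Finset.Nat.antidiagonal_succ']
    simp [hy']

/-- The coefficients of the solution of `F x = v`, where `F = ∑ (-t) ^ m L m` and `L 0 = 1`. -/
theorem coeff_eq_sum_composition (T F : M →+ M) (c : ℕ → M →+ V) (b : V → M)
    (L : ℕ → Module.End K V) (hFT : ∀ x, F (T x) = T (F x))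
    (hT0 : ∀ x, c 0 (T x) = 0) (hT : ∀ m x, c (m + 1) (T x) = c m x)
    (hdec : ∀ x, ∃ y, x = b (c 0 x) + T y) (hb0 : ∀ v, c 0 (b v) = v)
    (hb : ∀ v m, c (m + 1) (b v) = 0)
    (hL : ∀ m v, c m (F (b v)) = (-1 : K) ^ m • L m v) (hL0 : L 0 = 1)
    {x : M} {v : V} (hx : F x = b v) (m : ℕ) :
    c m x = (-1 : K) ^ m •
      ∑ I : Composition m, (-1 : K) ^ I.length • compositionProd L I v := by
  have key := fun m => coeff_apply_eq_sum_antidiagonal T F c b L hFT hT0 hT hdec hb hL m x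
  rw [hx] at key
  induction m using Nat.strong_induction_on with
  | _ m ih =>
  cases m with
  | zero =>
    have h := key 0
    rw [hb0] at h
    have h0 : ∀ I : Composition 0, I.blocks = [] := fun I => I.blocks_eq_nil.2 rfl
    have : Subsingleton (Composition 0) :=
      ⟨fun I J => Composition.ext ((h0 I).trans (h0 J).symm)⟩
    rw [Fintype.sum_subsingleton _ (Composition.ones 0)]
    simp [h, hL0, compositionProd, h0]
  | succ m =>
    -- The coefficient of `b v` here is zero, and the term with `p.1 = 0` is `c (m + 1) x` because
    -- `L 0 = 1`; solving for it expresses it through lower coefficients.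
    have h := key (m + 1)
    rw [hb, Finset.Nat.sum_antidiagonal_succ,
      Finset.Nat.sum_antidiagonal_eq_sum_range_succ_mk, ← Fin.sum_univ_eq_sum_range
        (fun k => (-1 : K) ^ (k + 1) • L (k + 1) (c (m - k) x))] at h
    simp only [pow_zero, one_smul, hL0, Module.End.one_apply] at h
    rw [eq_neg_of_add_eq_zero_left h.symm]
    simp only [compositionProd, ← Composition.blocks_length]
    rw [sum_composition_succ (fun l => (-1 : K) ^ l.length • (l.map L).prod v),
      Finset.smul_sum, ← Finset.sum_neg_distrib]
    refine Finset.sum_congr rfl fun a _ => ?_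
    -- The powers of `-1` from `a + 1` and `m - a` combine to `(-1) ^ (m + 1)`; the remaining minus
    -- sign accounts for the extra block.
    rw [ih _ (by omega), map_smul, map_sum, smul_smul, ← pow_add,
      show (a : ℕ) + 1 + (m - a) = m + 1 by omega, ← smul_neg, ← Finset.sum_neg_distrib]
    congr 1
    refine Finset.sum_congr rfl fun J _ => ?_
    rw [map_smul, ← neg_smul]
    simp [compositionProd, pow_succ]

end Inversion

/-! ### Hasse–Schmidt families and divided powers of derivations -/

section HasseSchmidt

variable {K A B : Type*} [CommRing K] [Ring A] [Algebra K A] [Ring B] [Algebra K B]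

/-- Two Hasse–Schmidt families agreeing on the variables are equal. -/
theorem hasseSchmidt_ext {ι : Type*} [Fintype ι] (X : ι → A) (P : ℕ → AddSubgroup A)
    (hP0 : ∀ x, x ∈ P 0) (hPmul : ∀ k x y, x ∈ P 1 → y ∈ P k → x * y ∈ P (k + 1))
    (hP : ∀ x, (∀ k, x ∈ P k) → x = 0)
    (hdec : ∀ f : A, ∃ (r : K) (g : ι → A), f = r • 1 + ∑ i, X i * g i)
    (L M : ℕ → A →ₗ[K] A) (h1 : ∀ m, L m 1 = M m 1)
    (hLmul : ∀ m x y, L m (x * y) = ∑ p ∈ Finset.HasAntidiagonal.antidiagonal m, L p.1 x * L p.2 y)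
    (hMmul : ∀ m x y, M m (x * y) = ∑ p ∈ Finset.HasAntidiagonal.antidiagonal m, M p.1 x * M p.2 y)
    (hX : ∀ m i, L m (X i) = M m (X i)) (hXP : ∀ m i, L m (X i) ∈ P 1) (m : ℕ) :
    L m = M m := by
  -- Induction on the order `k`, for all `m` simultaneously. In `L (X i * g i) - M (X i * g i)` the
  -- first factors agree, leaving products of `L _ (X i)`, of order at least one, with differences
  -- at `g i`, of order at least `k`.
  have key : ∀ k m f, L m f - M m f ∈ P k := by
    intro k
    induction k with
    | zero => exact fun _ _ => hP0 _
    | succ k ih =>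
      intro m f
      obtain ⟨r, g, rfl⟩ := hdec f
      simp only [map_add, map_smul, map_sum, h1, hLmul, hMmul, add_sub_add_left_eq_sub,
        ← Finset.sum_sub_distrib, ← hX, ← mul_sub]
      exact sum_mem fun i _ => sum_mem fun p _ => hPmul _ _ _ (hXP _ _) (ih _ _)
  ext f
  exact sub_eq_zero.1 (hP _ fun k => key k m f)

/-- The iterated Leibniz rule. -/
theorem leibniz_iterate (D : B →ₗ[K] B) (hD : ∀ x y, D (x * y) = D x * y + x * D y)
    (m : ℕ) (x y : B) :
    (D ^ m) (x * y) =
      ∑ p ∈ Finset.HasAntidiagonal.antidiagonal m, m.choose p.1 • ((D ^ p.1) x * (D ^ p.2) y) := by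
  induction m with
  | zero => simp
  | succ m ih =>
    rw [pow_succ', Module.End.mul_apply, ih, map_sum,
      Finset.sum_antidiagonal_choose_succ_nsmul (fun i j => (D ^ i) x * (D ^ j) y),
      ← Finset.sum_add_distrib]
    refine Finset.sum_congr rfl fun p hp => ?_
    rw [map_nsmul, hD, ← Module.End.mul_apply, ← Module.End.mul_apply, ← pow_succ', ← pow_succ',
      smul_add, add_comm]
    congr 2
    -- Pascal's rule weights one of its two sums by `choose m p.2`, which equals `choose m p.1`.
    exact Nat.choose_symm_of_eq_add (Finset.HasAntidiagonal.mem_antidiagonal.1 hp).symm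

/-- The divided powers of a derivation of `B`, transported to `A` along `ι` and `π`. -/
def dividedPower [Algebra ℚ K] (ι : A →ₗ[K] B) (D : B →ₗ[K] B) (π : B →ₗ[K] A) (m : ℕ) :
    A →ₗ[K] A :=
  algebraMap ℚ K (1 / (m ! : ℚ)) • (π ∘ₗ (D ^ m) ∘ₗ ι)

/-- Dividing by `m !` turns the binomial coefficient of the iterated Leibniz rule into the product
of the two inverse factorials. -/
theorem dividedPower_mul [Algebra ℚ K] (ι : A →ₗ[K] B) (D : B →ₗ[K] B) (π : B →ₗ[K] A)
    (hι : ∀ x y, ι (x * y) = ι x * ι y) (hπ : ∀ x y, π (x * y) = π x * π y)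
    (hD : ∀ x y, D (x * y) = D x * y + x * D y) (m : ℕ) (x y : A) :
    dividedPower ι D π m (x * y) =
      ∑ p ∈ Finset.HasAntidiagonal.antidiagonal m, dividedPower ι D π p.1 x * dividedPower ι D π p.2 y := by
  simp only [dividedPower, LinearMap.smul_apply, LinearMap.comp_apply, hι, leibniz_iterate D hD,
    map_sum, map_nsmul, hπ, Finset.smul_sum]
  refine Finset.sum_congr rfl fun p hp => ?_
  rw [smul_mul_smul_comm, ← Nat.cast_smul_eq_nsmul K, smul_smul]
  congr 1
  rw [← map_mul, ← map_natCast (algebraMap ℚ K), ← map_mul]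
  congr 1
  have hp := Finset.HasAntidiagonal.mem_antidiagonal.1 hp
  subst hp
  rw [Nat.cast_add_choose]
  have h1 := Nat.factorial_ne_zero p.1
  have h2 := Nat.factorial_ne_zero p.2
  have h3 := Nat.factorial_ne_zero (p.1 + p.2)
  field_simp

theorem iterate_leibniz_one (D : B →ₗ[K] B) (hD : ∀ x y, D (x * y) = D x * y + x * D y)
    (m : ℕ) : (D ^ m) 1 = if m = 0 then 1 else 0 := by
  have h : D 1 = 0 := by simpa using hD 1 1
  cases m with
  | zero => simp
  | succ m => rw [pow_succ, Module.End.mul_apply, h]; simp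

theorem dividedPower_one [Algebra ℚ K] (ι : A →ₗ[K] B) (D : B →ₗ[K] B) (π : B →ₗ[K] A)
    (hι : ι 1 = 1) (hπ : π 1 = 1)
    (hD : ∀ x y, D (x * y) = D x * y + x * D y) (m : ℕ) :
    dividedPower ι D π m 1 = if m = 0 then 1 else 0 := by
  simp only [dividedPower, LinearMap.smul_apply, LinearMap.comp_apply, hι,
    iterate_leibniz_one D hD]
  split_ifs with h <;> simp [h, hπ]

end HasseSchmidt

namespace NCSeries

/-! ### Renaming noncommutative variables -/

section Rename

variable {σ τ υ R : Type*} [CommRing R]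

/-- Renaming preserves word length, and a finite alphabet has finitely many words of each length.
Hence the `finsum` in `rename` is a genuine finite sum. -/
theorem finite_setOf_map_eq [Finite σ] (ρ : σ → τ) (v : List τ) :
    {w : List σ | w.map ρ = v}.Finite :=
  (List.finite_length_eq σ v.length).subset fun w hw => by
    change w.length = v.length
    rw [← show w.map ρ = v from hw, List.length_map]

/-- Preimages of a nonempty word are sorted by their first letter. This recursion drives the
inductions on words for `rename`. -/
theorem finsum_map_eq_cons [Fintype σ] [DecidableEq τ] (ρ : σ → τ) (f : List σ → R) (y : τ)
    (v : List τ) :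
    ∑ᶠ (w : List σ) (_ : w.map ρ = y :: v), f w =
      ∑ x with ρ x = y, ∑ᶠ (w : List σ) (_ : w.map ρ = v), f (x :: w) := by
  have h : {w : List σ | w.map ρ = y :: v} =
      ⋃ x ∈ {x : σ | ρ x = y}, (x :: ·) '' {w : List σ | w.map ρ = v} := by
    ext w
    cases w <;> simp [and_comm]
  change ∑ᶠ (w : List σ) (_ : w ∈ {w : List σ | w.map ρ = y :: v}), f w = _
  rw [h, finsum_mem_biUnion _ (Set.toFinite _) fun x _ => (finite_setOf_map_eq ρ v).image _]
  · rw [← finsum_mem_finset_eq_sum]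
    simp only [Finset.mem_filter, Finset.mem_univ, true_and]
    refine finsum_congr fun x => finsum_congr fun _ => ?_
    rw [finsum_mem_image fun _ _ _ _ h => (List.cons.inj h).2]
    rfl
  · intro a _ b _ hab
    rw [Function.onFun, Set.disjoint_left]
    rintro _ ⟨w, _, rfl⟩ ⟨w', _, h'⟩
    exact hab (List.cons.inj h').1.symm

@[simp] theorem rename_nil [Finite σ] (ρ : σ → τ) (f : NCSeries σ R) : rename ρ f [] = f [] := by
  have h : ∀ f : List σ → R, ∑ᶠ (w : List σ) (_ : w.map ρ = []), f w = f [] := fun f => by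
    simp only [List.map_eq_nil_iff, finsum_cond_eq_left]
  exact h f

theorem rename_cons [Fintype σ] [DecidableEq τ] (ρ : σ → τ) (f : NCSeries σ R) (y : τ)
    (v : List τ) :
    rename ρ f (y :: v) = ∑ x with ρ x = y, rename ρ (leftQuot x f) v :=
  finsum_map_eq_cons ρ f y v

theorem rename_eq_zero [Finite σ] (ρ : σ → τ) (f : NCSeries σ R) {v : List τ}
    (h : ∀ w : List σ, w.map ρ ≠ v) : rename ρ f v = 0 :=
  finsum_mem_eq_zero_of_forall_eq_zero fun w hw => absurd hw (h w)

theorem leftQuot_rename [Fintype σ] [DecidableEq τ] (ρ : σ → τ) (f : NCSeries σ R) (y : τ) :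
    leftQuot y (rename ρ f) = ∑ x with ρ x = y, rename ρ (leftQuot x f) := by
  ext v
  rw [leftQuot_apply, rename_cons, sum_apply]

theorem rename_add [Finite σ] (ρ : σ → τ) (f g : NCSeries σ R) :
    rename ρ (f + g) = rename ρ f + rename ρ g := by
  ext v
  exact finsum_mem_add_distrib (finite_setOf_map_eq ρ v)

theorem rename_smul [Finite σ] (ρ : σ → τ) (r : R) (f : NCSeries σ R) :
    rename ρ (r • f) = r • rename ρ f := by
  ext v
  exact (mul_finsum_mem' (R := R) _ r (finite_setOf_map_eq ρ v)).symm

/-- Renaming as a linear map. -/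
noncomputable def renameLinearMap [Finite σ] (ρ : σ → τ) : NCSeries σ R →ₗ[R] NCSeries τ R where
  toFun := rename ρ
  map_add' := rename_add ρ
  map_smul' := rename_smul ρ

theorem rename_one [Finite σ] (ρ : σ → τ) : rename ρ (1 : NCSeries σ R) = 1 := by
  classical
  have := Fintype.ofFinite σ
  ext v
  cases v with
  | nil => simp
  | cons y v =>
    rw [rename_cons, one_cons]
    refine Finset.sum_eq_zero fun x _ => ?_
    exact finsum_mem_eq_zero_of_forall_eq_zero fun _ _ => rfl

theorem rename_mul [Finite σ] (ρ : σ → τ) (f g : NCSeries σ R) :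
    rename ρ (f * g) = rename ρ f * rename ρ g := by
  classical
  have := Fintype.ofFinite σ
  ext v
  induction v generalizing f with
  | nil => simp
  | cons y v ih =>
    simp only [rename_cons, mul_cons, leftQuot_mul, rename_add, rename_smul, add_apply, smul_apply,
      ih, rename_nil, leftQuot_rename, Finset.sum_add_distrib, Finset.mul_sum, Finset.sum_mul,
      sum_apply]

theorem rename_rename [Finite σ] [Finite τ] (ρ : σ → τ) (κ : τ → υ) (f : NCSeries σ R) :
    rename κ (rename ρ f) = rename (κ ∘ ρ) f := by
  classical
  have := Fintype.ofFinite σ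
  have := Fintype.ofFinite τ
  ext v
  induction v generalizing f with
  | nil => simp
  | cons y v ih =>
    have hsum : ∀ s : Finset σ, ∀ g : σ → NCSeries τ R,
        rename κ (∑ x ∈ s, g x) = ∑ x ∈ s, rename κ (g x) := fun s g =>
      map_sum (renameLinearMap κ) g s
    simp only [rename_cons, leftQuot_rename, hsum, sum_apply, ih, Function.comp_apply]
    rw [Finset.sum_sigma']
    refine Finset.sum_bij' (fun p _ => p.2) (fun x _ => ⟨ρ x, x⟩) ?_ ?_ ?_ ?_ ?_ <;> aesop

theorem rename_id [Finite σ] (f : NCSeries σ R) : rename id f = f := by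
  ext v
  have h : ∀ f : List σ → R, ∑ᶠ (w : List σ) (_ : w.map id = v), f w = f v := fun f => by
    simp only [List.map_id, finsum_cond_eq_left]
  exact h f

theorem leftQuot_X [DecidableEq σ] (x i : σ) :
    leftQuot x (X i : NCSeries σ R) = if i = x then 1 else 0 := by
  ext w
  by_cases hi : i = x
  · cases w <;> simp [X, hi]
  · simp [X, hi, Ne.symm hi]

theorem rename_X [Finite σ] [DecidableEq σ] [DecidableEq τ] (ρ : σ → τ) (i : σ) :
    rename ρ (X i : NCSeries σ R) = X (ρ i) := by
  have := Fintype.ofFinite σ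
  ext v
  cases v with
  | nil => simp [X]
  | cons y v =>
    have h0 : rename ρ (0 : NCSeries σ R) = 0 := (renameLinearMap ρ).map_zero
    rw [rename_cons, ← leftQuot_apply y (X (ρ i)) v, leftQuot_X]
    simp only [leftQuot_X, apply_ite (rename ρ), rename_one, h0]
    rw [← sum_apply, Finset.sum_ite_eq]
    simp

end Rename

/-! ### The frozen derivation, noncommutative case -/

section Frozen

variable {n : ℕ} {R : Type*} [CommRing R]

theorem doubledDeriv_rename_inr (H : Fin n → NCSeries (Fin n) R) (f : NCSeries (Fin n) R) :
    doubledDeriv H (rename Sum.inr f) = 0 := by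
  ext v
  rw [doubledDeriv, deriv_apply]
  refine Finset.sum_eq_zero fun p _ => Finset.sum_eq_zero fun q _ => Finset.sum_eq_zero ?_
  rintro (i | i) _
  · rw [rename_eq_zero, zero_mul]
    intro w hw
    exfalso
    have : Sum.inl i ∈ w.map (Sum.inr : Fin n → Fin n ⊕ Fin n) := by
      rw [hw]; simp
    simp at this
  · simp

theorem frozenDerivPow_eq [Algebra ℚ R] (H : Fin n → NCSeries (Fin n) R) (m : ℕ)
    (u : NCSeries (Fin n) R) :
    algebraMap ℚ R (1 / (m ! : ℚ)) • frozenDerivPow H m u =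
      dividedPower (renameLinearMap Sum.inl) (doubledDeriv H)
        (renameLinearMap (Sum.elim id id)) m u := rfl

/-- The first application yields `H i` in the letters `w`, which the derivation kills, so all higher
powers vanish. This is why `w = z` is imposed only at the end. -/
theorem dividedPower_X [Algebra ℚ R] (H : Fin n → NCSeries (Fin n) R) (m : ℕ) (i : Fin n) :
    dividedPower (renameLinearMap Sum.inl) (doubledDeriv H)
        (renameLinearMap (Sum.elim id id)) m (X i) =
      if m = 0 then X i else if m = 1 then H i else 0 := by
  rw [← frozenDerivPow_eq, frozenDerivPow, rename_X]
  match m with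
  | 0 => simp [rename_X]
  | 1 =>
    rw [pow_one, doubledDeriv, deriv_X]
    simp only [Sum.elim_inl, rename_rename, Sum.elim_comp_inr, rename_id]
    simp
  | m + 2 =>
    rw [pow_succ, pow_succ, Module.End.mul_apply, Module.End.mul_apply]
    conv_lhs => enter [2, 2, 2, 2]; rw [doubledDeriv, deriv_X]
    rw [Sum.elim_inl, doubledDeriv_rename_inr, map_zero]
    have h0 : rename (Sum.elim id id) (0 : NCSeries (Fin n ⊕ Fin n) R) = 0 :=
      (renameLinearMap _).map_zero
    simp [h0]

end Frozen

/-! ### The deformation and its inverse, noncommutative case -/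

section Deformation

variable {n : ℕ} {σ K : Type*} [CommRing K]

theorem tCoeff_mul (m : ℕ) (f g : NCSeries σ K⟦X⟧) :
    tCoeff m (f * g) =
      ∑ p ∈ Finset.HasAntidiagonal.antidiagonal m, tCoeff p.1 f * tCoeff p.2 g := by
  ext w
  simp only [tCoeff, sum_apply, mul_apply, map_sum, PowerSeries.coeff_mul]
  exact Finset.sum_comm

theorem base_mul (u v : NCSeries σ K) : base (u * v) = base u * base v := by
  ext w : 1
  simp [base, mul_apply]

theorem base_one : base (1 : NCSeries σ K) = 1 := by
  ext w : 1
  cases w <;> simp [base]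

theorem base_X [DecidableEq σ] (i : σ) : base (X i : NCSeries σ K) = X i := by
  ext w : 1
  by_cases h : w = [i] <;> simp [base, X, h]

theorem tCoeff_base (m : ℕ) (u : NCSeries σ K) : tCoeff m (base u) = if m = 0 then u else 0 := by
  ext w
  simp only [tCoeff, base, PowerSeries.coeff_C]
  split_ifs <;> rfl

theorem tCoeff_zero_smul (f : NCSeries σ K⟦X⟧) : tCoeff 0 ((PowerSeries.X : K⟦X⟧) • f) = 0 := by
  ext w
  simp [tCoeff]

theorem tCoeff_succ_smul (m : ℕ) (f : NCSeries σ K⟦X⟧) :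
    tCoeff (m + 1) ((PowerSeries.X : K⟦X⟧) • f) = tCoeff m f := by
  ext w
  simp [tCoeff]

theorem eq_base_add_smul (f : NCSeries σ K⟦X⟧) :
    f = base (tCoeff 0 f) + (PowerSeries.X : K⟦X⟧) • ofTCoeffs (fun m => tCoeff (m + 1) f) := by
  ext w m
  cases m <;> simp [tCoeff, base, ofTCoeffs]

/-- Extraction of the coefficient of `t ^ m` as an additive map. -/
noncomputable def tCoeffHom (m : ℕ) : NCSeries σ K⟦X⟧ →+ NCSeries σ K where
  toFun := tCoeff m
  map_zero' := by ext w; simp [tCoeff]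
  map_add' f g := by ext w; simp [tCoeff]

/-- Series all of whose coefficients at words of length less than `k` vanish. -/
noncomputable def lowVanishing (σ K : Type*) [CommRing K] (k : ℕ) : AddSubgroup (NCSeries σ K) where
  carrier := {f | ∀ w : List σ, w.length < k → f w = 0}
  zero_mem' := fun _ _ => rfl
  add_mem' hf hg w hw := by simp [hf w hw, hg w hw]
  neg_mem' {f} hf w hw := by
    change -(f w) = 0
    rw [hf w hw, neg_zero]

theorem mul_mem_lowVanishing (k : ℕ) (x y : NCSeries σ K) (hx : x ∈ lowVanishing σ K 1)
    (hy : y ∈ lowVanishing σ K k) : x * y ∈ lowVanishing σ K (k + 1) := by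
  intro w hw
  rw [mul_apply]
  refine Finset.sum_eq_zero fun j hj => ?_
  rw [Finset.mem_range] at hj
  cases j with
  | zero => rw [hx _ (by simp), zero_mul]
  | succ j => rw [hy _ (by rw [List.length_drop]; omega), mul_zero]

/-- Nonempty words are grouped by their first letter. -/
theorem eq_smul_one_add_sum [Fintype σ] [DecidableEq σ] (f : NCSeries σ K) :
    f = f [] • 1 + ∑ i, X i * leftQuot i f := by
  ext w
  cases w with
  | nil => simp [sum_apply, X]
  | cons x w =>
    rw [add_apply, sum_apply, smul_apply, one_cons, mul_zero, zero_add]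
    simp only [mul_cons, leftQuot_X, ite_mul, one_mul, zero_mul]
    rw [Finset.sum_add_distrib, ← sum_apply, Finset.sum_ite_eq']
    simp [X]

variable (F : NCSeries (Fin n) K⟦X⟧ ≃ₐ[K⟦X⟧] NCSeries (Fin n) K⟦X⟧)

theorem lam_mul (m : ℕ) (u v : NCSeries (Fin n) K) :
    lam F m (u * v) =
      ∑ p ∈ Finset.HasAntidiagonal.antidiagonal m, lam F p.1 u * lam F p.2 v := by
  change (-1 : K) ^ m • tCoeff m (F (base (u * v))) = _
  rw [base_mul, map_mul, tCoeff_mul, Finset.smul_sum]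
  refine Finset.sum_congr rfl fun p hp => ?_
  rw [← Finset.HasAntidiagonal.mem_antidiagonal.1 hp, pow_add, ← smul_mul_smul_comm]
  rfl

theorem lam_one (m : ℕ) : lam F m 1 = if m = 0 then 1 else 0 := by
  change (-1 : K) ^ m • tCoeff m (F (base 1)) = _
  rw [base_one, map_one, ← base_one (σ := Fin n) (K := K), tCoeff_base]
  split_ifs with h <;> simp [h]

variable {F}

theorem lam_X {H : Fin n → NCSeries (Fin n) K}
    (hF : ∀ i, F (X i) = X i - (PowerSeries.X : K⟦X⟧) • base (H i)) (m : ℕ) (i : Fin n) :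
    lam F m (X i) = if m = 0 then X i else if m = 1 then H i else 0 := by
  change (-1 : K) ^ m • tCoeffHom m (F (base (X i))) = _
  rw [base_X, hF, map_sub, ← base_X]
  change (-1 : K) ^ m • (tCoeff m (base (X i)) -
    tCoeff m ((PowerSeries.X : K⟦X⟧) • base (H i))) = _
  match m with
  | 0 => simp [tCoeff_base, tCoeff_zero_smul]
  | 1 => simp [tCoeff_base, tCoeff_succ_smul]
  | m + 2 => simp [tCoeff_base, tCoeff_succ_smul]

/-- Both sides are Hasse–Schmidt families with the same values on `1` and on the variables, and the
filtration by word length is separated. -/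
theorem lam_eq_dividedPower [Algebra ℚ K] {H : Fin n → NCSeries (Fin n) K}
    (hH : ∀ i, H i [] = 0)
    (hF : ∀ i, F (X i) = X i - (PowerSeries.X : K⟦X⟧) • base (H i)) (m : ℕ) :
    lam F m = dividedPower (renameLinearMap Sum.inl) (doubledDeriv H)
      (renameLinearMap (Sum.elim id id)) m := by
  have hD : ∀ x y, doubledDeriv H (x * y) = doubledDeriv H x * y + x * doubledDeriv H y :=
    deriv_mul _
  refine hasseSchmidt_ext X (lowVanishing (Fin n) K) (fun x w hw => absurd hw (Nat.not_lt_zero _))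
    mul_mem_lowVanishing (fun x hx => ext fun w => hx (w.length + 1) w (Nat.lt_succ_self _))
    (fun f => ⟨_, _, eq_smul_one_add_sum f⟩) (lam F) _ ?_ (lam_mul F) ?_ ?_ ?_ m
  · intro m
    rw [lam_one]
    exact (dividedPower_one _ _ _ (rename_one _) (rename_one _) hD m).symm
  · exact dividedPower_mul _ _ _ (rename_mul _) (rename_mul _) hD
  · intro m i
    rw [lam_X hF, dividedPower_X]
  -- Order at least one of `lam F m (X i)`: for `m = 1` this is the vanishing constant term of `H
  -- i`.
  · intro m i w hw
    obtain rfl : w = [] := List.length_eq_zero_iff.1 (by omega)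
    rw [lam_X hF]
    split_ifs
    · simp [X]
    · exact hH i
    · rfl

/-- At `t = 0` the map `F` is visibly the identity only on the variables; the identification with
divided powers extends this to all series. -/
theorem lam_zero [Algebra ℚ K] {H : Fin n → NCSeries (Fin n) K} (hH : ∀ i, H i [] = 0)
    (hF : ∀ i, F (X i) = X i - (PowerSeries.X : K⟦X⟧) • base (H i)) : lam F 0 = 1 := by
  rw [lam_eq_dividedPower hH hF]
  ext u : 1
  rw [← frozenDerivPow_eq]
  simp [frozenDerivPow, rename_rename, rename_id]

theorem invCoeff_eq [Algebra ℚ K] {H : Fin n → NCSeries (Fin n) K} (hH : ∀ i, H i [] = 0)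
    (hF : ∀ i, F (X i) = X i - (PowerSeries.X : K⟦X⟧) • base (H i)) (m : ℕ) (i : Fin n) :
    invCoeff F m i = (-1 : K) ^ m • ∑ I : Composition m, (-1 : K) ^ I.length •
      compositionProd (A := Module.End K (NCSeries (Fin n) K)) (lam F) I (X i) := by
  refine coeff_eq_sum_composition (DistribSMul.toAddMonoidHom _ (PowerSeries.X : K⟦X⟧))
    (F : NCSeries (Fin n) K⟦X⟧ →+ NCSeries (Fin n) K⟦X⟧) tCoeffHom base (lam F)
    (fun x => map_smul F _ x) tCoeff_zero_smul tCoeff_succ_smul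
    (fun x => ⟨_, eq_base_add_smul x⟩) (fun v => by exact tCoeff_base 0 v)
    (fun v m => by exact tCoeff_base (m + 1) v) (fun m v => ?_) (lam_zero hH hF)
    (x := F.symm (X i)) (by simp [base_X]) m
  -- The sign built into `lam` cancels the sign of the Taylor expansion.
  change tCoeff m (F (base v)) = (-1 : K) ^ m • (-1 : K) ^ m • tCoeff m (F (base v))
  rw [smul_smul, ← pow_add, Even.neg_one_pow ⟨m, rfl⟩, one_smul]

theorem symm_X_eq [Algebra ℚ K] {H : Fin n → NCSeries (Fin n) K} (hH : ∀ i, H i [] = 0)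
    (hF : ∀ i, F (X i) = X i - (PowerSeries.X : K⟦X⟧) • base (H i)) (i : Fin n) :
    F.symm (X i) = X i +
      (PowerSeries.X : K⟦X⟧) • ofTCoeffs (fun m => invCoeff F (m + 1) i) := by
  -- The inversion formula at `m = 0`, where only the empty composition contributes.
  have h0 : tCoeff 0 (F.symm (X i)) = X i := by
    change invCoeff F 0 i = _
    have h0 : ∀ I : Composition 0, I.blocks = [] := fun I => I.blocks_eq_nil.2 rfl
    have : Subsingleton (Composition 0) :=
      ⟨fun I J => Composition.ext ((h0 I).trans (h0 J).symm)⟩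
    rw [invCoeff_eq hH hF, Fintype.sum_subsingleton _ (Composition.ones 0)]
    simp [compositionProd, h0]
  conv_lhs => rw [eq_base_add_smul (F.symm (X i)), h0, base_X]
  rfl

end Deformation

end NCSeries

namespace CommSeries

/-! ### Renaming commuting variables and partial derivatives -/

section Rename

variable {σ τ R : Type*} [CommRing R]

/-- Renaming as an algebra homomorphism. -/
noncomputable def renameAlgHom [Finite σ] (ρ : σ → τ) :
    MvPowerSeries σ R →ₐ[R] MvPowerSeries τ R :=
  have : Filter.TendstoCofinite ρ := Filter.tendstoCofinite_of_finite ρ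
  MvPowerSeries.rename ρ

theorem rename_rename {υ : Type*} [Finite σ] [Finite τ] (ρ : σ → τ) (κ : τ → υ)
    (f : MvPowerSeries σ R) : rename κ (rename ρ f) = rename (κ ∘ ρ) f := by
  have : Filter.TendstoCofinite ρ := Filter.tendstoCofinite_of_finite ρ
  have : Filter.TendstoCofinite κ := Filter.tendstoCofinite_of_finite κ
  exact MvPowerSeries.rename_rename ρ κ f

theorem rename_id [Finite σ] (f : MvPowerSeries σ R) : rename id f = f :=
  MvPowerSeries.rename_id_apply f

theorem rename_X [Finite σ] (ρ : σ → τ) (i : σ) :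
    rename ρ (MvPowerSeries.X i : MvPowerSeries σ R) = MvPowerSeries.X (ρ i) := by
  have : Filter.TendstoCofinite ρ := Filter.tendstoCofinite_of_finite ρ
  exact MvPowerSeries.rename_X ρ i

theorem coeff_rename_eq_zero [Finite σ] (ρ : σ → τ) (f : MvPowerSeries σ R) {y : τ →₀ ℕ} {j : τ}
    (hj : j ∉ Set.range ρ) (hy : y j ≠ 0) : MvPowerSeries.coeff y (rename ρ f) = 0 := by
  have : Filter.TendstoCofinite ρ := Filter.tendstoCofinite_of_finite ρ
  refine MvPowerSeries.coeff_rename_eq_zero ρ f ?_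
  rintro ⟨x, rfl⟩
  exact hy (Finsupp.mapDomain_of_notMem_range x j hj)

theorem pderiv_rename_of_notMem [Finite σ] (ρ : σ → τ) (f : MvPowerSeries σ R) {j : τ}
    (hj : j ∉ Set.range ρ) : MvPowerSeries.pderiv R j (rename ρ f) = 0 := by
  ext y
  rw [MvPowerSeries.coeff_pderiv, coeff_rename_eq_zero ρ f hj (by simp), zero_mul, map_zero]

theorem pderiv_rename [Finite σ] (ρ : σ ↪ τ) (f : MvPowerSeries σ R) (i : σ) :
    MvPowerSeries.pderiv R (ρ i) (rename ρ f) = rename ρ (MvPowerSeries.pderiv R i f) := by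
  have hc : ∀ (g : MvPowerSeries σ R) x,
      MvPowerSeries.coeff (Finsupp.embDomain ρ x) (rename ρ g) = MvPowerSeries.coeff x g := by
    have : Filter.TendstoCofinite ρ := Filter.tendstoCofinite_of_finite ρ
    exact fun g x => MvPowerSeries.coeff_embDomain_rename ρ g x
  ext y
  -- An exponent involving a variable outside the range of `ρ` has coefficient zero on both sides;
  -- every other exponent comes from one on `σ`.
  by_cases h : ∃ j, j ∉ Set.range ρ ∧ y j ≠ 0
  · obtain ⟨j, hj, hy⟩ := h
    rw [MvPowerSeries.coeff_pderiv, coeff_rename_eq_zero ρ _ hj hy,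
      coeff_rename_eq_zero ρ _ hj (by simp [hy]), zero_mul]
  · push Not at h
    obtain ⟨x, rfl⟩ : ∃ x, Finsupp.embDomain ρ x = y := by
      refine ⟨y.comapDomain ρ ρ.injective.injOn, ?_⟩
      rw [Finsupp.embDomain_eq_mapDomain, Finsupp.mapDomain_comapDomain _ ρ.injective]
      intro j hj
      by_contra hj'
      exact (Finsupp.mem_support_iff.1 hj) (h j hj')
    rw [MvPowerSeries.coeff_pderiv, hc, ← Finsupp.embDomain_single, ← Finsupp.embDomain_add, hc,
      MvPowerSeries.coeff_pderiv, Finsupp.embDomain_apply_self]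

theorem pderiv_comm (i j : σ) (f : MvPowerSeries σ R) :
    MvPowerSeries.pderiv R i (MvPowerSeries.pderiv R j f) =
      MvPowerSeries.pderiv R j (MvPowerSeries.pderiv R i f) := by
  classical
  by_cases h : i = j
  · rw [h]
  ext e
  simp only [MvPowerSeries.coeff_pderiv, Finsupp.add_apply, Finsupp.single_apply, if_neg h,
    if_neg (Ne.symm h), add_zero, add_right_comm e]
  ring

end Rename

/-! ### The frozen derivation, commutative case -/

section Frozen

variable {n : ℕ} {R : Type*} [CommRing R]

theorem deriv_apply {σ : Type*} [Fintype σ] (u : σ → MvPowerSeries σ R) (f : MvPowerSeries σ R) :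
    deriv u f = ∑ i, u i * MvPowerSeries.pderiv R i f := by
  simp [deriv]

theorem deriv_mul {σ : Type*} [Fintype σ] (u : σ → MvPowerSeries σ R) (f g : MvPowerSeries σ R) :
    deriv u (f * g) = deriv u f * g + f * deriv u g := by
  simp only [deriv_apply, Derivation.leibniz, smul_eq_mul, Finset.sum_mul, Finset.mul_sum,
    ← Finset.sum_add_distrib]
  refine Finset.sum_congr rfl fun i _ => ?_
  ring

theorem deriv_X {σ : Type*} [Fintype σ] [DecidableEq σ] (u : σ → MvPowerSeries σ R) (j : σ) :
    deriv u (MvPowerSeries.X j) = u j := by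
  rw [deriv_apply, Finset.sum_eq_single j]
  · simp
  · intro i _ hi
    rw [MvPowerSeries.pderiv_X_of_ne (Ne.symm hi), mul_zero]
  · simp

theorem doubledDeriv_apply (H : Fin n → MvPowerSeries (Fin n) R)
    (f : MvPowerSeries (Fin n ⊕ Fin n) R) :
    doubledDeriv H f = ∑ i, rename Sum.inr (H i) * MvPowerSeries.pderiv R (Sum.inl i) f := by
  simp [doubledDeriv, deriv_apply]

theorem doubledDeriv_rename_inr (H : Fin n → MvPowerSeries (Fin n) R)
    (f : MvPowerSeries (Fin n) R) : doubledDeriv H (rename Sum.inr f) = 0 := by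
  rw [doubledDeriv_apply]
  refine Finset.sum_eq_zero fun i _ => ?_
  rw [pderiv_rename_of_notMem _ _ (by simp), mul_zero]

theorem frozenDerivPow_eq [Algebra ℚ R] (H : Fin n → MvPowerSeries (Fin n) R) (m : ℕ)
    (u : MvPowerSeries (Fin n) R) :
    algebraMap ℚ R (1 / (m ! : ℚ)) • frozenDerivPow H m u =
      dividedPower (renameAlgHom Sum.inl).toLinearMap (doubledDeriv H)
        (renameAlgHom (Sum.elim id id)).toLinearMap m u := rfl

theorem dividedPower_X [Algebra ℚ R] (H : Fin n → MvPowerSeries (Fin n) R) (m : ℕ) (i : Fin n) :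
    dividedPower (renameAlgHom Sum.inl).toLinearMap (doubledDeriv H)
        (renameAlgHom (Sum.elim id id)).toLinearMap m (MvPowerSeries.X i) =
      if m = 0 then MvPowerSeries.X i else if m = 1 then H i else 0 := by
  rw [← frozenDerivPow_eq, frozenDerivPow, rename_X]
  match m with
  | 0 => simp [rename_X]
  | 1 =>
    rw [pow_one, doubledDeriv, deriv_X]
    simp only [Sum.elim_inl, rename_rename, Sum.elim_comp_inr, rename_id]
    simp
  | m + 2 =>
    rw [pow_succ, pow_succ, Module.End.mul_apply, Module.End.mul_apply]
    conv_lhs => enter [2, 2, 2, 2]; rw [doubledDeriv, deriv_X]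
    rw [Sum.elim_inl, doubledDeriv_rename_inr, map_zero]
    have h0 : rename (Sum.elim id id) (0 : MvPowerSeries (Fin n ⊕ Fin n) R) = 0 :=
      map_zero (renameAlgHom _)
    simp [h0]

/-- The summand `H_i(w) ∂/∂z_i` of the derivation `[H(w) ∂/∂z]`. -/
noncomputable def doubledSummand (H : Fin n → MvPowerSeries (Fin n) R) (i : Fin n) :
    Module.End R (MvPowerSeries (Fin n ⊕ Fin n) R) :=
  LinearMap.mulLeft R (rename Sum.inr (H i)) ∘ₗ
    (MvPowerSeries.pderiv R (Sum.inl i)).toLinearMap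

theorem doubledSummand_apply (H : Fin n → MvPowerSeries (Fin n) R) (i : Fin n)
    (f : MvPowerSeries (Fin n ⊕ Fin n) R) :
    doubledSummand H i f = rename Sum.inr (H i) * MvPowerSeries.pderiv R (Sum.inl i) f := rfl

/-- The coefficients involve only `w`, so the derivatives in `z` pass through them, and partial
derivatives commute. -/
theorem doubledSummand_commute (H : Fin n → MvPowerSeries (Fin n) R) (i j : Fin n) :
    Commute (doubledSummand H i) (doubledSummand H j) := by
  refine LinearMap.ext fun f => ?_
  simp only [Module.End.mul_apply, doubledSummand_apply, Derivation.leibniz, smul_eq_mul]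
  rw [pderiv_rename_of_notMem _ _ (by simp), pderiv_rename_of_notMem _ _ (by simp), pderiv_comm]
  ring

/-- Products of a series in `w` and a series in `z` are stable under these operators. The extra
factor `h` lets powers for different `i` be composed. -/
theorem doubledSummand_pow_apply (H : Fin n → MvPowerSeries (Fin n) R) (i : Fin n) (k : ℕ)
    (h v : MvPowerSeries (Fin n) R) :
    (doubledSummand H i ^ k) (rename Sum.inr h * rename Sum.inl v) =
      rename Sum.inr (H i ^ k * h) *
        rename Sum.inl (((MvPowerSeries.pderiv R i).toLinearMap ^ k) v) := by
  induction k with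
  | zero => simp
  | succ k ih =>
    have hm : ∀ a b : MvPowerSeries (Fin n) R, (rename Sum.inr (a * b) :
        MvPowerSeries (Fin n ⊕ Fin n) R) = rename Sum.inr a * rename Sum.inr b :=
      map_mul (renameAlgHom Sum.inr)
    rw [pow_succ', Module.End.mul_apply, ih, doubledSummand_apply, Derivation.leibniz,
      pderiv_rename_of_notMem Sum.inr _ (by simp), smul_zero, add_zero, smul_eq_mul, ← mul_assoc,
      ← hm,
      ← mul_assoc, ← pow_succ', pow_succ' (MvPowerSeries.pderiv R i).toLinearMap]
    congr 1
    exact pderiv_rename Function.Embedding.inl _ i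

theorem prod_doubledSummand_pow_apply (H : Fin n → MvPowerSeries (Fin n) R) (I : Fin n → ℕ)
    (u : MvPowerSeries (Fin n) R) (l : List (Fin n)) :
    (l.map fun i => doubledSummand H i ^ I i).prod (rename Sum.inl u) =
      rename Sum.inr (l.map fun i => H i ^ I i).prod *
        rename Sum.inl ((l.map fun i => ((MvPowerSeries.pderiv R i).toLinearMap :
          Module.End R (MvPowerSeries (Fin n) R)) ^ I i).prod u) := by
  induction l with
  | nil =>
    have h1 : (rename Sum.inr (1 : MvPowerSeries (Fin n) R) :
        MvPowerSeries (Fin n ⊕ Fin n) R) = 1 := map_one (renameAlgHom _)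
    simp [h1]
  | cons i l ih =>
    rw [List.map_cons, List.prod_cons, Module.End.mul_apply, ih, doubledSummand_pow_apply]
    simp only [List.map_cons, List.prod_cons, Module.End.mul_apply]

theorem frozenDerivPow_eq_sum (H : Fin n → MvPowerSeries (Fin n) R) (m : ℕ)
    (u : MvPowerSeries (Fin n) R) :
    frozenDerivPow H m u = ∑ I ∈ Finset.piAntidiag (Finset.univ : Finset (Fin n)) m,
      (Nat.multinomial Finset.univ I : R) • ((∏ i, H i ^ I i) * partialPow (R := R) I u) := by
  have hD : doubledDeriv H = ∑ i, doubledSummand H i :=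
    LinearMap.ext fun f => by
      rw [doubledDeriv_apply, LinearMap.sum_apply]; rfl
  rw [frozenDerivPow, hD, Finset.sum_pow_eq_sum_piAntidiag_of_commute _ _
    fun i _ j _ _ => doubledSummand_commute H i j, LinearMap.sum_apply]
  change renameAlgHom (Sum.elim id id) _ = _
  rw [map_sum]
  refine Finset.sum_congr rfl fun I _ => ?_
  -- Fixes the order of the commuting factors to that of the list product in `partialPow`.
  have hl : Finset.univ.noncommProd (fun i => doubledSummand H i ^ I i)
      (fun i _ j _ _ => (doubledSummand_commute H i j).pow_pow _ _) =
      ((List.finRange n).map fun i => doubledSummand H i ^ I i).prod := by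
    rw [← Finset.noncommProd_toFinset (List.finRange n) (fun i => doubledSummand H i ^ I i)
      (fun i _ j _ _ => (doubledSummand_commute H i j).pow_pow _ _) (List.nodup_finRange n)]
    exact Finset.noncommProd_congr (by ext; simp) (fun _ _ => rfl) _
  rw [hl, Module.End.mul_apply, prod_doubledSummand_pow_apply, Module.End.natCast_apply,
    ← Nat.cast_smul_eq_nsmul R, map_smul, map_mul]
  congr 2
  · refine (rename_rename _ _ _).trans ?_
    rw [Sum.elim_comp_inr, rename_id, ← List.ofFn_eq_map, List.prod_ofFn]
  · refine (rename_rename _ _ _).trans ?_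
    rw [Sum.elim_comp_inl, rename_id, ← List.ofFn_eq_map, partialPow]

/-- The multinomial coefficient divided by `m !` is the inverse of `∏ i, (I i)!`. -/
theorem dividedPower_apply_eq_sum [Algebra ℚ R] (H : Fin n → MvPowerSeries (Fin n) R) (m : ℕ)
    (u : MvPowerSeries (Fin n) R) :
    algebraMap ℚ R (1 / (m ! : ℚ)) • frozenDerivPow H m u =
      ∑ I ∈ Finset.piAntidiag (Finset.univ : Finset (Fin n)) m,
        algebraMap ℚ R (1 / ((∏ i, (I i)! : ℕ) : ℚ)) •
          ((∏ i, H i ^ I i) * partialPow (R := R) I u) := by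
  rw [frozenDerivPow_eq_sum, Finset.smul_sum]
  refine Finset.sum_congr rfl fun I hI => ?_
  rw [smul_smul]
  congr 1
  rw [← map_natCast (algebraMap ℚ R), ← map_mul]
  congr 1
  have h := Nat.multinomial_spec Finset.univ I
  rw [(Finset.mem_piAntidiag.1 hI).1] at h
  have h1 : ((∏ i, (I i)! : ℕ) : ℚ) ≠ 0 :=
    Nat.cast_ne_zero.2 (Finset.prod_ne_zero_iff.2 fun i _ => Nat.factorial_ne_zero _)
  have h2 : (m ! : ℚ) ≠ 0 := Nat.cast_ne_zero.2 (Nat.factorial_ne_zero m)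
  rw [div_mul_eq_mul_div, one_mul, div_eq_div_iff h2 h1, one_mul, mul_comm]
  exact_mod_cast h

end Frozen

/-! ### The deformation and its inverse, commutative case -/

section Deformation

open MvPowerSeries (X coeff)

variable {n : ℕ} {σ K : Type*} [CommRing K]

theorem coeff_tCoeff (m : ℕ) (f : MvPowerSeries σ K⟦X⟧) (e : σ →₀ ℕ) :
    coeff e (tCoeff m f) = PowerSeries.coeff m (coeff e f) := rfl

theorem tCoeff_mul (m : ℕ) (f g : MvPowerSeries σ K⟦X⟧) :
    tCoeff m (f * g) =
      ∑ p ∈ Finset.HasAntidiagonal.antidiagonal m, tCoeff p.1 f * tCoeff p.2 g := by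
  classical
  ext e
  simp only [coeff_tCoeff, map_sum, MvPowerSeries.coeff_mul, PowerSeries.coeff_mul]
  exact Finset.sum_comm

theorem tCoeff_base (m : ℕ) (u : MvPowerSeries σ K) :
    tCoeff m (base u) = if m = 0 then u else 0 := by
  ext e
  rw [coeff_tCoeff, base, MvPowerSeries.coeff_map, PowerSeries.coeff_C]
  split_ifs <;> simp

theorem base_X (i : σ) : base (X i : MvPowerSeries σ K) = X i := MvPowerSeries.map_X _ i

theorem tCoeff_zero_smul (f : MvPowerSeries σ K⟦X⟧) :
    tCoeff 0 ((PowerSeries.X : K⟦X⟧) • f) = 0 := by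
  ext e
  simp [coeff_tCoeff]

theorem tCoeff_succ_smul (m : ℕ) (f : MvPowerSeries σ K⟦X⟧) :
    tCoeff (m + 1) ((PowerSeries.X : K⟦X⟧) • f) = tCoeff m f := by
  ext e
  simp [coeff_tCoeff]

theorem eq_base_add_smul (f : MvPowerSeries σ K⟦X⟧) :
    f = base (tCoeff 0 f) + (PowerSeries.X : K⟦X⟧) • ofTCoeffs (fun m => tCoeff (m + 1) f) := by
  ext e m
  have h : coeff e (ofTCoeffs fun m => tCoeff (m + 1) f) =
      PowerSeries.mk fun m => PowerSeries.coeff (m + 1) (coeff e f) := rfl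
  cases m <;> simp [coeff_tCoeff, base, h]

/-- Extraction of the coefficient of `t ^ m` as an additive map. -/
noncomputable def tCoeffHom (m : ℕ) : MvPowerSeries σ K⟦X⟧ →+ MvPowerSeries σ K where
  toFun := tCoeff m
  map_zero' := by ext e; simp [coeff_tCoeff]
  map_add' f g := by ext e; simp [coeff_tCoeff]

/-- Series all of whose coefficients in degrees less than `k` vanish. -/
def lowVanishing (σ K : Type*) [CommRing K] (k : ℕ) : AddSubgroup (MvPowerSeries σ K) where
  carrier := {f | ∀ e : σ →₀ ℕ, e.degree < k → coeff e f = 0}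
  zero_mem' := fun _ _ => map_zero _
  add_mem' hf hg e he := by rw [map_add, hf e he, hg e he, add_zero]
  neg_mem' {f} hf e he := by rw [map_neg, hf e he, neg_zero]

theorem mul_mem_lowVanishing (k : ℕ) (x y : MvPowerSeries σ K) (hx : x ∈ lowVanishing σ K 1)
    (hy : y ∈ lowVanishing σ K k) : x * y ∈ lowVanishing σ K (k + 1) := by
  classical
  intro e he
  rw [MvPowerSeries.coeff_mul]
  refine Finset.sum_eq_zero fun p hp => ?_
  have hd := congrArg Finsupp.degree (Finset.HasAntidiagonal.mem_antidiagonal.1 hp)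
  rw [map_add] at hd
  by_cases h : p.1.degree < 1
  · rw [hx _ h, zero_mul]
  · rw [hy _ (by omega), mul_zero]

/-- A monomial may be divisible by several variables, so each nonconstant one is assigned to the
smallest variable occurring in it; `g i` collects those assigned to `i`, divided by `X i`. -/
theorem exists_eq_smul_one_add_sum (f : MvPowerSeries (Fin n) K) :
    ∃ (r : K) (g : Fin n → MvPowerSeries (Fin n) K), f = r • 1 + ∑ i, X i * g i := by
  classical
  obtain ⟨g, hg⟩ : ∃ g : Fin n → MvPowerSeries (Fin n) K, ∀ i e, coeff e (g i) =
      if ∀ j < i, e j = 0 then coeff (e + Finsupp.single i 1) f else 0 :=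
    ⟨fun i e => if ∀ j < i, e j = 0 then coeff (e + Finsupp.single i 1) f else 0, fun _ _ => rfl⟩
  refine ⟨coeff 0 f, g, MvPowerSeries.ext fun e => ?_⟩
  simp only [map_add, map_sum, X, MvPowerSeries.coeff_monomial_mul, map_smul,
    MvPowerSeries.coeff_one, hg, one_mul, smul_eq_mul]
  by_cases he : e = 0
  · simp [he]
  have hex : ∃ i, e i ≠ 0 := by
    by_contra! h
    exact he (Finsupp.ext h)
  obtain ⟨i, hi, hmin⟩ := WellFounded.has_min (wellFounded_lt (α := Fin n)) {i | e i ≠ 0} hex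
  have hlt : ∀ j < i, e j = 0 := fun j hj => by_contra fun h => hmin j h hj
  have hle : ∀ {j}, e j ≠ 0 → Finsupp.single j 1 ≤ e := fun h =>
    Finsupp.single_le_iff.2 (Nat.one_le_iff_ne_zero.2 h)
  rw [if_neg he, mul_zero, zero_add, Finset.sum_eq_single i]
  · rw [if_pos (hle hi), if_pos, tsub_add_cancel_of_le (hle hi)]
    intro j hj
    rw [Finsupp.tsub_apply, hlt j hj, Nat.zero_sub]
  -- Any other variable `j` in the monomial satisfies `i < j`, and `e i ≠ 0` violates the condition
  -- defining `g j`.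
  · intro j _ hj
    split_ifs with h1 h2
    · exfalso
      have hj0 : e j ≠ 0 := Nat.one_le_iff_ne_zero.1 (Finsupp.single_le_iff.1 h1)
      have hij : i < j := lt_of_le_of_ne (not_lt.1 (hmin j hj0)) (Ne.symm hj)
      have h3 := h2 i hij
      rw [Finsupp.tsub_apply, Finsupp.single_eq_of_ne (Ne.symm hj), Nat.sub_zero] at h3
      exact hi h3
    · rfl
    · rfl
  · simp

variable (F : MvPowerSeries (Fin n) K⟦X⟧ ≃ₐ[K⟦X⟧] MvPowerSeries (Fin n) K⟦X⟧)

theorem lam_mul (m : ℕ) (u v : MvPowerSeries (Fin n) K) :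
    lam F m (u * v) =
      ∑ p ∈ Finset.HasAntidiagonal.antidiagonal m, lam F p.1 u * lam F p.2 v := by
  change (-1 : K) ^ m • tCoeff m (F (base (u * v))) = _
  rw [base, map_mul, map_mul, tCoeff_mul, Finset.smul_sum]
  refine Finset.sum_congr rfl fun p hp => ?_
  rw [← Finset.HasAntidiagonal.mem_antidiagonal.1 hp, pow_add, ← smul_mul_smul_comm]
  rfl

theorem lam_one (m : ℕ) : lam F m 1 = if m = 0 then 1 else 0 := by
  have h1 : base (1 : MvPowerSeries (Fin n) K) = 1 := map_one _
  change (-1 : K) ^ m • tCoeff m (F (base 1)) = _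
  rw [h1, map_one, ← h1, tCoeff_base]
  split_ifs with h <;> simp [h]

variable {F}

theorem lam_X {H : Fin n → MvPowerSeries (Fin n) K}
    (hF : ∀ i, F (X i) = X i - (PowerSeries.X : K⟦X⟧) • base (H i)) (m : ℕ) (i : Fin n) :
    lam F m (X i) = if m = 0 then X i else if m = 1 then H i else 0 := by
  change (-1 : K) ^ m • tCoeffHom m (F (base (X i))) = _
  rw [base_X, hF, map_sub, ← base_X]
  change (-1 : K) ^ m • (tCoeff m (base (X i)) -
    tCoeff m ((PowerSeries.X : K⟦X⟧) • base (H i))) = _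
  match m with
  | 0 => simp [tCoeff_base, tCoeff_zero_smul]
  | 1 => simp [tCoeff_base, tCoeff_succ_smul]
  | m + 2 => simp [tCoeff_base, tCoeff_succ_smul]

theorem lam_eq_dividedPower [Algebra ℚ K] {H : Fin n → MvPowerSeries (Fin n) K}
    (hH : ∀ i, MvPowerSeries.constantCoeff (H i) = 0)
    (hF : ∀ i, F (X i) = X i - (PowerSeries.X : K⟦X⟧) • base (H i)) (m : ℕ) :
    lam F m = dividedPower (renameAlgHom Sum.inl).toLinearMap (doubledDeriv H)
      (renameAlgHom (Sum.elim id id)).toLinearMap m := by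
  have hD : ∀ x y, doubledDeriv H (x * y) = doubledDeriv H x * y + x * doubledDeriv H y :=
    deriv_mul _
  refine hasseSchmidt_ext X (lowVanishing (Fin n) K) (fun x w hw => absurd hw (Nat.not_lt_zero _))
    mul_mem_lowVanishing
    (fun x hx => MvPowerSeries.ext fun e => hx (e.degree + 1) e (Nat.lt_succ_self _))
    exists_eq_smul_one_add_sum (lam F) _ ?_ (lam_mul F) ?_ ?_ ?_ m
  · intro m
    rw [lam_one]
    exact (dividedPower_one _ _ _ (map_one (renameAlgHom _)) (map_one (renameAlgHom _)) hD m).symm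
  · exact dividedPower_mul _ _ _ (map_mul (renameAlgHom _)) (map_mul (renameAlgHom _)) hD
  · intro m i
    rw [lam_X hF, dividedPower_X]
  · intro m i e he
    obtain rfl : e = 0 := (Finsupp.degree_eq_zero_iff e).1 (by omega)
    rw [lam_X hF]
    split_ifs
    · simp
    · exact hH i
    · simp

theorem lam_zero [Algebra ℚ K] {H : Fin n → MvPowerSeries (Fin n) K}
    (hH : ∀ i, MvPowerSeries.constantCoeff (H i) = 0)
    (hF : ∀ i, F (X i) = X i - (PowerSeries.X : K⟦X⟧) • base (H i)) : lam F 0 = 1 := by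
  rw [lam_eq_dividedPower hH hF]
  refine LinearMap.ext fun u => ?_
  rw [← frozenDerivPow_eq]
  simp [frozenDerivPow, rename_rename, rename_id]

theorem invCoeff_eq [Algebra ℚ K] {H : Fin n → MvPowerSeries (Fin n) K}
    (hH : ∀ i, MvPowerSeries.constantCoeff (H i) = 0)
    (hF : ∀ i, F (X i) = X i - (PowerSeries.X : K⟦X⟧) • base (H i)) (m : ℕ) (i : Fin n) :
    invCoeff F m i = (-1 : K) ^ m • ∑ I : Composition m, (-1 : K) ^ I.length •
      compositionProd (A := Module.End K (MvPowerSeries (Fin n) K)) (lam F) I (X i) := by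
  refine coeff_eq_sum_composition (DistribSMul.toAddMonoidHom _ (PowerSeries.X : K⟦X⟧))
    (F : MvPowerSeries (Fin n) K⟦X⟧ →+ MvPowerSeries (Fin n) K⟦X⟧) tCoeffHom base (lam F)
    (fun x => map_smul F _ x) tCoeff_zero_smul tCoeff_succ_smul
    (fun x => ⟨_, eq_base_add_smul x⟩) (fun v => by exact tCoeff_base 0 v)
    (fun v m => by exact tCoeff_base (m + 1) v) (fun m v => ?_) (lam_zero hH hF)
    (x := F.symm (X i)) (by simp [base_X]) m
  change tCoeff m (F (base v)) = (-1 : K) ^ m • (-1 : K) ^ m • tCoeff m (F (base v))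
  rw [smul_smul, ← pow_add, Even.neg_one_pow ⟨m, rfl⟩, one_smul]

theorem symm_X_eq [Algebra ℚ K] {H : Fin n → MvPowerSeries (Fin n) K}
    (hH : ∀ i, MvPowerSeries.constantCoeff (H i) = 0)
    (hF : ∀ i, F (X i) = X i - (PowerSeries.X : K⟦X⟧) • base (H i)) (i : Fin n) :
    F.symm (X i) = X i +
      (PowerSeries.X : K⟦X⟧) • ofTCoeffs (fun m => invCoeff F (m + 1) i) := by
  have h0 : tCoeff 0 (F.symm (X i)) = X i := by
    change invCoeff F 0 i = _
    have h0 : ∀ I : Composition 0, I.blocks = [] := fun I => I.blocks_eq_nil.2 rfl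
    have : Subsingleton (Composition 0) :=
      ⟨fun I J => Composition.ext ((h0 I).trans (h0 J).symm)⟩
    rw [invCoeff_eq hH hF, Fintype.sum_subsingleton _ (Composition.ones 0)]
    simp [compositionProd, h0]
  conv_lhs => rw [eq_base_add_smul (F.symm (X i)), h0, base_X]
  rfl

end Deformation

end CommSeries

theorem mainTheorem7 {K : Type*} [CommRing K] [Algebra ℚ K] (n : ℕ) :
    -- noncommutative free variables
    (∀ (H : Fin n → NCSeries (Fin n) K)
        (F : NCSeries (Fin n) K⟦X⟧ ≃ₐ[K⟦X⟧] NCSeries (Fin n) K⟦X⟧),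
      (∀ i, H i [] = 0) →
      (∀ i, F (NCSeries.X i) =
        NCSeries.X i - (PowerSeries.X : K⟦X⟧) • NCSeries.base (H i)) →
      (∀ i, F.symm (NCSeries.X i) = NCSeries.X i +
        (PowerSeries.X : K⟦X⟧) • NCSeries.ofTCoeffs (fun m => NCSeries.invCoeff F (m + 1) i)) ∧
      (∀ m : ℕ, 1 ≤ m → ∀ i, NCSeries.invCoeff F m i =
        (-1 : K) ^ m • ∑ I : Composition m, (-1 : K) ^ I.length •
          compositionProd (A := Module.End K (NCSeries (Fin n) K)) (NCSeries.lam F) I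
            (NCSeries.X i)) ∧
      (∀ m : ℕ, 1 ≤ m → ∀ u : NCSeries (Fin n) K, NCSeries.lam F m u =
        algebraMap ℚ K (1 / (m ! : ℚ)) • NCSeries.frozenDerivPow H m u)) ∧
    -- commutative variables
    (∀ (H : Fin n → MvPowerSeries (Fin n) K)
        (F : MvPowerSeries (Fin n) K⟦X⟧ ≃ₐ[K⟦X⟧] MvPowerSeries (Fin n) K⟦X⟧),
      (∀ i, MvPowerSeries.constantCoeff (H i) = 0) →
      (∀ i, F (MvPowerSeries.X i) =
        MvPowerSeries.X i - (PowerSeries.X : K⟦X⟧) • CommSeries.base (H i)) →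
      (∀ i, F.symm (MvPowerSeries.X i) = MvPowerSeries.X i +
        (PowerSeries.X : K⟦X⟧) •
          CommSeries.ofTCoeffs (fun m => CommSeries.invCoeff F (m + 1) i)) ∧
      (∀ m : ℕ, 1 ≤ m → ∀ i, CommSeries.invCoeff F m i =
        (-1 : K) ^ m • ∑ I : Composition m, (-1 : K) ^ I.length •
          compositionProd (A := Module.End K (MvPowerSeries (Fin n) K)) (CommSeries.lam F) I
            (MvPowerSeries.X i)) ∧
      (∀ m : ℕ, 1 ≤ m → ∀ u : MvPowerSeries (Fin n) K, CommSeries.lam F m u =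
        algebraMap ℚ K (1 / (m ! : ℚ)) • CommSeries.frozenDerivPow H m u) ∧
      (∀ m : ℕ, 1 ≤ m → ∀ u : MvPowerSeries (Fin n) K, CommSeries.lam F m u =
        ∑ I ∈ Finset.piAntidiag (Finset.univ : Finset (Fin n)) m,
          algebraMap ℚ K (1 / ((∏ i, (I i)! : ℕ) : ℚ)) •
            ((∏ i, H i ^ I i) * CommSeries.partialPow (R := K) I u))) := by

  refine ⟨fun H F hH hF => ⟨NCSeries.symm_X_eq hH hF, fun m _ => NCSeries.invCoeff_eq hH hF m,
    fun m _ u => ?_⟩, fun H F hH hF => ⟨CommSeries.symm_X_eq hH hF,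
    fun m _ => CommSeries.invCoeff_eq hH hF m, fun m _ u => ?_, fun m _ u => ?_⟩⟩
  · rw [NCSeries.lam_eq_dividedPower hH hF, NCSeries.frozenDerivPow_eq]
  · rw [CommSeries.lam_eq_dividedPower hH hF, CommSeries.frozenDerivPow_eq]
  · rw [CommSeries.lam_eq_dividedPower hH hF, ← CommSeries.frozenDerivPow_eq,
      CommSeries.dividedPower_apply_eq_sum]
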